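/- Let $K$ be a number field, $E/K$ an elliptic curve, $n\ge 1$ an integer, and $F/K$ a finite Galois extension of degree $d=[F:K]$ with $\gcd(n,d)=1$. Fix an algebraic closure $\overline{K}$ of $K$ containing $F$. For $L\in\{K,F\}$ and a place $v$ of $L$ (finite or infinite) let $L_v$ be the completion, and for $k = L$ or $k=L_v$ let $H^1(k,E[n])$ denote the continuous cohomology group $H^1(\mathrm{Gal}(\overline{k}/k),E(\overline{k})[n])$. Let \[\mathrm{Sel}_n(E/L)=\ker\Big(H^1(L,E[n])\to\prod_v \frac{H^1(L_v,E[n])}{\mathrm{im}(\kappa_v)}\Big),\] where $v$ runs over all places of $L$ and $\kappa_v:E(L_v)/nE(L_v)\to H^1(L_v,E[n])$ is the Kummer map, which sends the class of $nQ\in E(L_v)$, with $Q\in E(\overline{L_v})$, to the class of $\sigma\mapsto \sigma Q-Q$. Let $\mathrm{Gal}(F/K)$ act on $H^1(F,E[n])$ in the natural way: $\sigma$ sends the class of a cocycle $c$ to the class of $g\mapsto\tau\, c(\tau^{-1}g\tau)$, where $\tau\in\mathrm{Gal}(\overline{K}/K)$ is any extension of $\sigma$. Then the restriction map $H^1(K,E[n])\to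 H^1(F,E[n])$ induces an isomorphism of groups \[\mathrm{Sel}_n(E/K)\;\cong\;\mathrm{Sel}_n(E/F)^{\mathrm{Gal}(F/K)}.\] -/

import Mathlib

/-! ### Continuous group cohomology in degree one -/

section Cohomology

variable (G A : Type*) [Group G] [TopologicalSpace G] [AddCommGroup A] [DistribMulAction G A]

/-- The group `Z¹(G, A)` of continuous `1`-cocycles of a topological group `G` with values in a
discrete `G`-module `A`: the maps `c : G → A` with `c (gh) = c g + g • c h` that are continuous
for the discrete topology on `A`, that is, locally constant. -/
def contCocycles1 : AddSubgroup (G → A) where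
  carrier := {c | (∀ g h : G, c (g * h) = c g + g • c h) ∧ IsLocallyConstant c}
  zero_mem' := ⟨fun g h => by simp, IsLocallyConstant.const 0⟩
  add_mem' := by
    rintro a b ⟨ha, ha'⟩ ⟨hb, hb'⟩
    refine ⟨fun g h => ?_, ha'.add hb'⟩
    simp only [Pi.add_apply, ha g h, hb g h, smul_add]
    abel
  neg_mem' := by
    rintro a ⟨ha, ha'⟩
    refine ⟨fun g h => ?_, ha'.neg⟩
    simp only [Pi.neg_apply, ha g h, smul_neg]
    abel

/-- The group `B¹(G, A)` of `1`-coboundaries: the maps `g ↦ g • a - a` for `a` in `A`. -/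
def coboundaries1 : AddSubgroup (G → A) where
  carrier := {c | ∃ a : A, ∀ g : G, c g = g • a - a}
  zero_mem' := ⟨0, fun g => by simp⟩
  add_mem' := by
    rintro c d ⟨a, ha⟩ ⟨b, hb⟩
    refine ⟨a + b, fun g => ?_⟩
    simp only [Pi.add_apply, ha g, hb g, smul_add]
    abel
  neg_mem' := by
    rintro c ⟨a, ha⟩
    refine ⟨-a, fun g => ?_⟩
    simp only [Pi.neg_apply, ha g, smul_neg]
    abel

/-- The first continuous cohomology group `H¹(G, A) = Z¹(G, A) / B¹(G, A)` of a topological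
group `G` with values in a discrete `G`-module `A`. -/
abbrev ContH1 : Type _ :=
  contCocycles1 G A ⧸ (coboundaries1 G A).addSubgroupOf (contCocycles1 G A)

variable {G A}

/-- The class in `H¹(G, A)` of a continuous cocycle. -/
def ContH1.mk : contCocycles1 G A →+ ContH1 G A :=
  QuotientAddGroup.mk' _

variable {H B : Type*} [Group H] [TopologicalSpace H] [AddCommGroup B] [DistribMulAction H B]

/-- Pull-back of cocycles along a compatible pair `φ : H → G`, `f : A → B`. -/
def contCocycles1Map (φ : H →* G) (hφ : Continuous φ) (f : A →+ B)
    (hf : ∀ (h : H) (a : A), f (φ h • a) = h • f a) : contCocycles1 G A →+ contCocycles1 H B where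
  toFun c := ⟨fun h => f (c.1 (φ h)), by
    refine ⟨fun g h => ?_, ?_⟩
    · change f (c.1 (φ (g * h))) = f (c.1 (φ g)) + g • f (c.1 (φ h))
      rw [map_mul, c.2.1, map_add, hf]
    · exact (c.2.2.comp_continuous hφ).comp f⟩
  map_zero' := by ext; simp
  map_add' c d := by ext; simp

/-- The homomorphism `H¹(G, A) → H¹(H, B)`, `[c] ↦ [f ∘ c ∘ φ]`, attached to a compatible pair
consisting of a continuous homomorphism `φ : H → G` and a homomorphism `f : A → B`. -/
def ContH1.map (φ : H →* G) (hφ : Continuous φ) (f : A →+ B)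
    (hf : ∀ (h : H) (a : A), f (φ h • a) = h • f a) : ContH1 G A →+ ContH1 H B :=
  QuotientAddGroup.map _ _ (contCocycles1Map φ hφ f hf) (by
    rintro c ⟨a, ha⟩
    refine ⟨f a, fun h => ?_⟩
    change f (c.1 (φ h)) = _
    have := ha (φ h)
    rw [← hf, ← map_sub, ← this]
    rfl)

end Cohomology

/-! ### Absolute Galois groups -/

section Galois

/-- The stabilizer of an algebraic element is a neighbourhood of `1` in the Galois group. -/
theorem eventually_galois_apply_eq {L Ω : Type*} [Field L] [Field Ω] [Algebra L Ω]
    [Algebra.IsAlgebraic L Ω] (x : Ω) : ∀ᶠ g : Ω ≃ₐ[L] Ω in nhds 1, g x = x := by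
  have hx : IsIntegral L x := Algebra.IsIntegral.isIntegral x
  have := IntermediateField.adjoin.finiteDimensional hx
  have h := (IntermediateField.adjoin L {x}).fixingSubgroup_isOpen.mem_nhds (one_mem _)
  filter_upwards [h] with g hg
  exact (IntermediateField.mem_fixingSubgroup_iff _ g).1 hg x
    (IntermediateField.mem_adjoin_simple_self L x)

/-- A homomorphism to a Galois group is continuous as soon as the stabilizers are open. -/
theorem continuous_galois_hom {G L Ω : Type*} [Group G] [TopologicalSpace G]
    [IsTopologicalGroup G] [Field L] [Field Ω] [Algebra L Ω]
    (φ : G →* (Ω ≃ₐ[L] Ω)) (h : ∀ x : Ω, ∀ᶠ g in nhds (1 : G), φ g x = x) : Continuous φ := by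
  refine continuous_of_continuousAt_one φ ?_
  rw [ContinuousAt, map_one]
  intro s hs
  obtain ⟨E, hE, hEs⟩ := (krullTopology_mem_nhds_one_iff L Ω s).1 hs
  obtain ⟨S, hS⟩ := IntermediateField.essFiniteType_iff.1
    (inferInstance : Algebra.EssFiniteType L E)
  have hev : ∀ᶠ g in nhds (1 : G), ∀ x ∈ S, φ g x = x := (Filter.eventually_all_finset S).2
    fun x _ => h x
  refine Filter.mem_map.2 ?_
  filter_upwards [hev] with g hg
  refine hEs ((IntermediateField.mem_fixingSubgroup_iff _ _).2 ?_)
  have hle : E ≤ IntermediateField.fixedField (Subgroup.zpowers (φ g)) := by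
    rw [← hS, IntermediateField.adjoin_le_iff]
    intro x hx
    rw [SetLike.mem_coe, IntermediateField.mem_fixedField_iff]
    intro f hf
    have : Subgroup.zpowers (φ g) ≤ MulAction.stabilizer (Ω ≃ₐ[L] Ω) x := by
      rw [Subgroup.zpowers_le]
      exact hg x hx
    exact this hf
  intro x hx
  exact (IntermediateField.mem_fixedField_iff _ _).1 (hle hx) _ (Subgroup.mem_zpowers _)

variable {L M Ω Ω' : Type*} [Field L] [Field M] [Field Ω] [Field Ω'] [Algebra L Ω] [Algebra L M]
  [Algebra M Ω'] [Algebra L Ω'] [IsScalarTower L M Ω']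

/-- Restriction `Gal(Ω'/M) → Gal(Ω/L)`, `τ ↦ τ|_Ω`, along an `L`-embedding `ι : Ω → Ω'` of a
normal extension `Ω` of `L` into an extension `Ω'` of a field `M ⊇ L`. -/
noncomputable def galRes [Normal L Ω] (ι : Ω →ₐ[L] Ω') : (Ω' ≃ₐ[M] Ω') →* (Ω ≃ₐ[L] Ω) :=
  letI : Algebra Ω Ω' := ι.toRingHom.toAlgebra
  haveI : IsScalarTower L Ω Ω' := IsScalarTower.of_algebraMap_eq fun x => (ι.commutes x).symm
  (AlgEquiv.restrictNormalHom Ω).comp (AlgEquiv.restrictScalarsHom L)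

theorem galRes_commutes [Normal L Ω] (ι : Ω →ₐ[L] Ω') (τ : Ω' ≃ₐ[M] Ω') (x : Ω) :
    ι (galRes ι τ x) = τ (ι x) := by
  let : Algebra Ω Ω' := ι.toRingHom.toAlgebra
  have : IsScalarTower L Ω Ω' := IsScalarTower.of_algebraMap_eq fun x => (ι.commutes x).symm
  exact AlgEquiv.restrictNormal_commutes (τ.restrictScalars L) Ω x

theorem galRes_continuous [Normal L Ω] [Algebra.IsAlgebraic M Ω'] (ι : Ω →ₐ[L] Ω') :
    Continuous (galRes (M := M) ι) := by
  refine continuous_galois_hom _ fun x => ?_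
  filter_upwards [eventually_galois_apply_eq (L := M) (ι x)] with τ hτ
  exact ι.injective ((galRes_commutes ι τ x).trans hτ)

variable {K F Ω : Type*} [Field K] [Field F] [Field Ω] [Algebra K F] [Algebra K Ω] [Algebra F Ω]
  [IsScalarTower K F Ω]

/-- For `F/K` normal and `τ` in `Gal(Ω/K)`, the automorphism `g ↦ τ⁻¹ g τ` of `Gal(Ω/F)`. -/
noncomputable def galConj [Normal K F] (τ : Ω ≃ₐ[K] Ω) : (Ω ≃ₐ[F] Ω) →* (Ω ≃ₐ[F] Ω) where
  toFun g := AlgEquiv.ofRingEquiv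
    (f := ((τ.toRingEquiv.trans g.toRingEquiv).trans τ.symm.toRingEquiv)) fun x => by
      change τ.symm (g (τ (algebraMap F Ω x))) = _
      rw [← AlgEquiv.restrictNormal_commutes τ F x, g.commutes,
        AlgEquiv.restrictNormal_commutes, AlgEquiv.symm_apply_apply]
  map_one' := by
    ext x
    exact τ.symm_apply_apply x
  map_mul' g h := by
    ext x
    change τ.symm (g (h (τ x))) = τ.symm (g (τ (τ.symm (h (τ x)))))
    rw [AlgEquiv.apply_symm_apply]

theorem galConj_apply [Normal K F] (τ : Ω ≃ₐ[K] Ω) (g : Ω ≃ₐ[F] Ω) (x : Ω) :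
    galConj τ g x = τ.symm (g (τ x)) := rfl

theorem galConj_continuous [Normal K F] [Algebra.IsAlgebraic F Ω] (τ : Ω ≃ₐ[K] Ω) :
    Continuous (galConj (F := F) τ) := by
  refine continuous_galois_hom _ fun x => ?_
  filter_upwards [eventually_galois_apply_eq (L := F) (τ x)] with g hg
  rw [galConj_apply, hg, AlgEquiv.symm_apply_apply]

end Galois

/-- The completion of `L` at an infinite place, as an extension of a subfield `K` of `L`. -/
instance infinitePlaceCompletion_isScalarTower {K L : Type*} [Field K] [Field L] [Algebra K L]
    (w : NumberField.InfinitePlace L) : IsScalarTower K L w.Completion :=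
  IsScalarTower.of_algebraMap_eq fun x => by
    apply NumberField.InfinitePlace.Completion.ext
    exact congrArg (UniformSpace.Completion.coeRingHom (α := WithAbs w.1))
      (IsScalarTower.algebraMap_apply K L (WithAbs w.1) x)

/-! ### Selmer groups of elliptic curves

Throughout, `W` is a Weierstrass curve over a field `K`, and we consider it over extensions of
`K`; `W⁄Ω` is its base change to `Ω`. -/

namespace WeierstrassCurve

noncomputable section

open scoped Classical WeierstrassCurve.Affine

variable {K : Type*} [Field K] (W : WeierstrassCurve K)

section Points

variable (L Ω : Type*) [Field L] [Field Ω] [Algebra K L] [Algebra K Ω] [Algebra L Ω]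
  [IsScalarTower K L Ω]

/-- The coordinatewise action of `Gal(Ω/L)` on the group of points `E(Ω)`. -/
instance galoisActionPoint : DistribMulAction (Ω ≃ₐ[L] Ω) (W⁄Ω).Point where
  smul σ P := Affine.Point.map (W' := W) (S := L) (σ : Ω →ₐ[L] Ω) P
  one_smul P := by cases P <;> rfl
  mul_smul σ τ P := by cases P <;> rfl
  smul_zero σ := rfl
  smul_add σ P Q := map_add (Affine.Point.map (W' := W) (S := L) (σ : Ω →ₐ[L] Ω)) P Q

variable {L} in
theorem galois_smul_point_def (σ : Ω ≃ₐ[L] Ω) (P : (W⁄Ω).Point) :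
    σ • P = Affine.Point.map (W' := W) (S := L) (σ : Ω →ₐ[L] Ω) P := rfl

/-- The group `E[n] = E(Ω)[n]` of `n`-torsion points with coordinates in `Ω`. -/
abbrev nTorsion (n : ℕ) : AddSubgroup (W⁄Ω).Point := AddSubgroup.torsionBy (W⁄Ω).Point (n : ℤ)

variable {Ω} in
theorem mem_nTorsion_iff {n : ℕ} {P : (W⁄Ω).Point} : P ∈ W.nTorsion Ω n ↔ n • P = 0 := by
  rw [← natCast_zsmul]
  rfl

/-- The action of `Gal(Ω/L)` on `E[n]`. -/
instance galoisActionTorsion (n : ℕ) : DistribMulAction (Ω ≃ₐ[L] Ω) (W.nTorsion Ω n) where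
  smul σ P := ⟨σ • P.1, by
    rw [mem_nTorsion_iff, galois_smul_point_def, ← map_nsmul, (W.mem_nTorsion_iff).1 P.2,
      map_zero]⟩
  one_smul P := Subtype.ext (one_smul _ P.1)
  mul_smul σ τ P := Subtype.ext (mul_smul σ τ P.1)
  smul_zero σ := Subtype.ext (smul_zero σ)
  smul_add σ P Q := Subtype.ext (smul_add σ P.1 Q.1)

variable {L Ω} in
theorem coe_galois_smul_nTorsion {n : ℕ} (σ : Ω ≃ₐ[L] Ω) (P : W.nTorsion Ω n) :
    ((σ • P : W.nTorsion Ω n) : (W⁄Ω).Point) = σ • (P : (W⁄Ω).Point) := rfl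

/-- `H¹(L, E[n]) = H¹(Gal(Ω/L), E(Ω)[n])`, where `Ω` is an algebraic closure of `L`. -/
abbrev galH1 (n : ℕ) : Type _ := ContH1 (Ω ≃ₐ[L] Ω) (W.nTorsion Ω n)

/-- The image of the Kummer map `κ : E(L)/nE(L) → H¹(L, E[n])`, where `Ω` is an algebraic closure
of `L`. The map `κ` sends the class of `P` to the class of the cocycle `σ ↦ σ Q - Q`, where `Q` is
a point of `E(Ω)` such that `n Q = P`. -/
def kummerImage (n : ℕ) : AddSubgroup (W.galH1 L Ω n) where
  carrier := {x | ∃ (P : (W⁄L).Point) (Q : (W⁄Ω).Point) (c : contCocycles1 (Ω ≃ₐ[L] Ω)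
      (W.nTorsion Ω n)), n • Q = Affine.Point.baseChange (W' := W) L Ω P ∧
      (∀ σ : Ω ≃ₐ[L] Ω, (c.1 σ : (W⁄Ω).Point) = σ • Q - Q) ∧ ContH1.mk c = x}
  zero_mem' := ⟨0, 0, 0, by simp, fun σ => by simp, map_zero _⟩
  add_mem' := by
    rintro _ _ ⟨P, Q, c, h, hc, rfl⟩ ⟨P', Q', c', h', hc', rfl⟩
    refine ⟨P + P', Q + Q', c + c', by rw [nsmul_add, h, h', map_add], fun σ => ?_, map_add _ _ _⟩
    have : (((c + c').1 σ : W.nTorsion Ω n) : (W⁄Ω).Point) = c.1 σ + c'.1 σ := rfl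
    rw [this, hc, hc', smul_add]
    abel
  neg_mem' := by
    rintro _ ⟨P, Q, c, h, hc, rfl⟩
    refine ⟨-P, -Q, -c, by rw [neg_nsmul, h, map_neg], fun σ => ?_, map_neg _ _⟩
    have : (((-c).1 σ : W.nTorsion Ω n) : (W⁄Ω).Point) = -(c.1 σ : (W⁄Ω).Point) := rfl
    rw [this, hc, smul_neg]
    abel

end Points

section Restriction

variable {L Ω Ω' : Type*} [Field L] [Field Ω] [Field Ω'] [Algebra K L] [Algebra K Ω]
  [Algebra L Ω] [IsScalarTower K L Ω] [Algebra K Ω'] [Algebra L Ω'] [IsScalarTower K L Ω']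

/-- The map `E(Ω)[n] → E(Ω')[n]` induced by an embedding `ι : Ω → Ω'`. -/
def nTorsionMap (n : ℕ) (ι : Ω →ₐ[L] Ω') : W.nTorsion Ω n →+ W.nTorsion Ω' n where
  toFun P := ⟨Affine.Point.map (W' := W) ι P.1, by
    rw [mem_nTorsion_iff, ← map_nsmul, (W.mem_nTorsion_iff).1 P.2, map_zero]⟩
  map_zero' := Subtype.ext (map_zero _)
  map_add' P Q := Subtype.ext (map_add _ P.1 Q.1)

/-- For an extension `M/L` of fields with algebraic closures `Ω'` of `M` and `Ω` of `L`, and an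
`L`-embedding `ι : Ω → Ω'`, the restriction map `H¹(L, E[n]) → H¹(M, E[n])` that sends the class
of a cocycle `c` to the class of `τ ↦ ι (c (τ|_Ω))`. -/
def galH1Res (M : Type*) [Field M] [Algebra K M] [Algebra L M] [Algebra M Ω']
    [IsScalarTower L M Ω'] [IsScalarTower K M Ω'] [Normal L Ω] [Algebra.IsAlgebraic M Ω']
    (n : ℕ) (ι : Ω →ₐ[L] Ω') : W.galH1 L Ω n →+ W.galH1 M Ω' n :=
  ContH1.map (galRes ι) (galRes_continuous ι) (W.nTorsionMap n ι) (by
    rintro τ ⟨P, hP⟩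
    refine Subtype.ext ?_
    change Affine.Point.map (W' := W) ι (Affine.Point.map (W' := W) _ P) =
      Affine.Point.map (W' := W) _ (Affine.Point.map (W' := W) ι P)
    rcases P with _ | ⟨x, y, h⟩
    · rfl
    · simp only [Affine.Point.map_some, Affine.Point.some.injEq]
      exact ⟨galRes_commutes ι τ x, galRes_commutes ι τ y⟩)

end Restriction

section Selmer

variable (L Ω : Type*) [Field L] [NumberField L] [Field Ω] [Algebra K L] [Algebra K Ω]
  [Algebra L Ω] [IsScalarTower K L Ω] [IsAlgClosure L Ω]

instance normal_of_isAlgClosure_numberField : Normal L Ω := IsAlgClosure.normal L Ω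

/-- The `n`-Selmer group `Sel_n(E/L)` of `E` over a number field `L ⊇ K` with algebraic closure
`Ω`: the classes in `H¹(L, E[n])` that for every place `v` of `L`, finite or infinite, are sent to
the image of the Kummer map `κ_v` by the restriction map `H¹(L, E[n]) → H¹(L_v, E[n])`.
The restriction map is formed with an `L`-embedding `ι` of `Ω` into the algebraic closure of `L_v`.
Two embeddings differ by an element of `Gal(Ω/L)` and so give the same restriction map; rather
than choosing one, the definition runs over all of them. -/
def selmerGroup (n : ℕ) : AddSubgroup (W.galH1 L Ω n) :=
  (⨅ (v : IsDedekindDomain.HeightOneSpectrum (NumberField.RingOfIntegers L))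
      (ι : Ω →ₐ[L] AlgebraicClosure (v.adicCompletion L)),
    (W.kummerImage (v.adicCompletion L) (AlgebraicClosure (v.adicCompletion L)) n).comap
      (W.galH1Res (v.adicCompletion L) n ι)) ⊓
  (⨅ (v : NumberField.InfinitePlace L) (ι : Ω →ₐ[L] AlgebraicClosure v.Completion),
    (W.kummerImage v.Completion (AlgebraicClosure v.Completion) n).comap
      (W.galH1Res v.Completion n ι))

end Selmer

section Invariants

variable (F Ω : Type*) [Field F] [Field Ω] [Algebra K F] [Algebra K Ω] [Algebra F Ω]
  [IsScalarTower K F Ω] [Normal K F] [Algebra.IsAlgebraic F Ω]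

variable {F Ω} in
/-- For `F/K` normal, the action of `τ` in `Gal(Ω/K)` on `H¹(F, E[n])`: the class of a cocycle `c`
is sent to the class of `g ↦ τ (c (τ⁻¹ g τ))`. -/
def galH1Conj (n : ℕ) (τ : Ω ≃ₐ[K] Ω) : W.galH1 F Ω n →+ W.galH1 F Ω n :=
  ContH1.map (galConj τ) (galConj_continuous τ) (DistribSMul.toAddMonoidHom (W.nTorsion Ω n) τ) (by
    rintro g ⟨P, hP⟩
    refine Subtype.ext ?_
    change Affine.Point.map (W' := W) _ (Affine.Point.map (W' := W) _ P) =
      Affine.Point.map (W' := W) _ (Affine.Point.map (W' := W) _ P)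
    rcases P with _ | ⟨x, y, h⟩
    · rfl
    · simp only [Affine.Point.map_some, Affine.Point.some.injEq]
      exact ⟨τ.apply_symm_apply _, τ.apply_symm_apply _⟩)

variable {F Ω} in
/-- Elements of `Gal(Ω/F)` act trivially on `H¹(F, E[n])`. -/
theorem galH1Conj_of_fixes (n : ℕ) (h : Ω ≃ₐ[F] Ω) (x : W.galH1 F Ω n) :
    W.galH1Conj n (h.restrictScalars K) x = x := by
  induction x using QuotientAddGroup.induction_on with
  | H c =>
  refine QuotientAddGroup.eq.2 ?_
  refine ⟨-c.1 h, fun g => ?_⟩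
  have hg : galConj (h.restrictScalars K) g = h⁻¹ * (g * h) := rfl
  change -(h • c.1 (galConj (h.restrictScalars K) g)) + c.1 g = _
  have e1 : c.1 (h * (h⁻¹ * (g * h))) = _ := c.2.1 h _
  rw [mul_inv_cancel_left, c.2.1 g h] at e1
  rw [hg, eq_sub_of_add_eq' e1.symm, smul_neg]
  abel

variable {F Ω} in
theorem galH1Conj_mul (n : ℕ) (σ τ : Ω ≃ₐ[K] Ω) (x : W.galH1 F Ω n) :
    W.galH1Conj n (σ * τ) x = W.galH1Conj n σ (W.galH1Conj n τ x) := by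
  induction x using QuotientAddGroup.induction_on with
  | H c =>
  refine congrArg (QuotientAddGroup.mk (s := (coboundaries1 _ _).addSubgroupOf _))
    (Subtype.ext (funext fun g => ?_))
  exact mul_smul σ τ _

variable {F Ω} in
/-- The action of `Gal(Ω/K)` on `H¹(F, E[n])` factors through `Gal(F/K)`. -/
theorem galH1Conj_congr (n : ℕ) (σ τ : Ω ≃ₐ[K] Ω)
    (h : ∀ x : F, σ (algebraMap F Ω x) = τ (algebraMap F Ω x)) (x : W.galH1 F Ω n) :
    W.galH1Conj n σ x = W.galH1Conj n τ x := by
  let g : Ω ≃ₐ[F] Ω := AlgEquiv.ofRingEquiv (f := (σ.toRingEquiv.trans τ.symm.toRingEquiv))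
    fun x => by
      change τ.symm (σ (algebraMap F Ω x)) = _
      rw [h, AlgEquiv.symm_apply_apply]
  have hσ : σ = τ * g.restrictScalars K := by
    ext x
    exact (τ.apply_symm_apply (σ x)).symm
  rw [hσ, galH1Conj_mul, galH1Conj_of_fixes]

variable [Normal K Ω]

/-- The natural action of `Gal(F/K)` on `H¹(F, E[n])`: an element `σ` acts as any extension `τ` of
`σ` to an automorphism of `Ω`, sending the class of `c` to the class of `g ↦ τ (c (τ⁻¹ g τ))`. -/
instance galoisActionH1 (n : ℕ) : DistribMulAction (F ≃ₐ[K] F) (W.galH1 F Ω n) where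
  smul σ x := W.galH1Conj n (σ.liftNormal Ω) x
  one_smul x := (W.galH1Conj_congr n _ ((1 : Ω ≃ₐ[F] Ω).restrictScalars K)
    (fun x => by rw [AlgEquiv.liftNormal_commutes]; rfl) x).trans (W.galH1Conj_of_fixes n 1 x)
  mul_smul σ τ x := (W.galH1Conj_congr n _ (σ.liftNormal Ω * τ.liftNormal Ω)
    (fun x => by
      rw [AlgEquiv.mul_apply]
      simp only [AlgEquiv.liftNormal_commutes]
      rfl) x).trans (W.galH1Conj_mul n _ _ x)
  smul_zero σ := map_zero _
  smul_add σ := map_add _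

/-- The action of `σ` is computed by every extension `τ` of `σ` to `Ω`. -/
theorem galoisActionH1_eq (n : ℕ) (σ : F ≃ₐ[K] F) (τ : Ω ≃ₐ[K] Ω)
    (h : ∀ x : F, τ (algebraMap F Ω x) = algebraMap F Ω (σ x)) (x : W.galH1 F Ω n) :
    σ • x = W.galH1Conj n τ x :=
  W.galH1Conj_congr n _ τ (fun x => by rw [AlgEquiv.liftNormal_commutes, h]) x

end Invariants

section SelmerInvariants

variable (F Ω : Type*) [Field F] [NumberField F] [Field Ω] [Algebra K F] [Algebra K Ω]
  [Algebra F Ω] [IsScalarTower K F Ω] [Normal K F] [Normal K Ω] [IsAlgClosure F Ω]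

instance isAlgebraic_of_isAlgClosure_numberField : Algebra.IsAlgebraic F Ω :=
  IsAlgClosure.isAlgebraic

/-- `Sel_n(E/F)^{Gal(F/K)}`: the classes in `Sel_n(E/F)` that are fixed by `Gal(F/K)`. -/
def selmerGroupInvariants (n : ℕ) : AddSubgroup (W.galH1 F Ω n) :=
  W.selmerGroup F Ω n ⊓ FixedPoints.addSubgroup (F ≃ₐ[K] F) (W.galH1 F Ω n)

end SelmerInvariants

end

end WeierstrassCurve

/-!
Let `d = [F : K]`, which is prime to `n`. Restriction is injective on `H¹(K, E[n])` because its
kernel is killed both by `d` (`index_nsmul_crossedHom_eq`) and by `n`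
(`WeierstrassCurve.galH1Res_id_injective`). Its image consists of invariant classes, and an invariant
class `y` is the restriction of `d⁻¹ cor y`, as `res (cor y)` is the sum of the conjugates of `y`
(`exists_corestriction`, `WeierstrassCurve.exists_galH1Res_eq_of_fixed`).

It remains to see that a class over `K` is a Selmer class exactly when its restriction to `F` is.
If `w` is a place of `F` above `v`, then Kummer classes over `K_v` restrict to Kummer classes over
`F_w`, and every `w` lies above some `v`; this gives one direction. For the other, pick one place `w`
above `v`. A class over `K_v` is a Kummer class if and only if it dies in `H¹(K_v, E)`. Suppose it
dies in `H¹(F_w, E)`. Since `F_w = K_v(F)`, because the finite dimensional `K_v`-subspace spanned by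
`F` is closed and dense in `F_w`, the group `Gal(F_w/K_v)` embeds in `Gal(F/K)`. So the class is
killed by a divisor of `d` and by `n`, and it is zero
(`WeierstrassCurve.galH1Res_mem_kummerImage_of_coprime`). A single place `w` suffices because the
restriction of a class over `K` does not depend on the embedding of the algebraic closures
(`WeierstrassCurve.galH1Res_eq`).
-/

/-! ### Crossed homomorphisms -/

section CrossedHom

variable {G A : Type*} [Group G] [AddCommGroup A] [DistribMulAction G A]

theorem crossedHom_one {c : G → A} (hc : ∀ g h, c (g * h) = c g + g • c h) : c 1 = 0 := by
  simpa using hc 1 1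

/-- Conjugation by `s` changes a crossed homomorphism by the coboundary of `c s`. -/
theorem crossedHom_conj_sub {c : G → A} (hc : ∀ g h, c (g * h) = c g + g • c h) (s g : G) :
    s • c (s⁻¹ * (g * s)) = c g + (g • c s - c s) := by
  have h := hc s (s⁻¹ * (g * s))
  rw [mul_inv_cancel_left, hc g s] at h
  rw [← add_sub_assoc, h, add_sub_cancel_left]

/-- The kernel of the restriction map to a subgroup of finite index is killed by the index. Once `c`
is modified by a coboundary to vanish on `H`, it descends to `G ⧸ H`, and the cocycle relation
summed over `G ⧸ H` shows that `[G : H] • c` is the coboundary of minus the sum of its values. -/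
theorem index_nsmul_crossedHom_eq (H : Subgroup G) [H.FiniteIndex] {c : G → A}
    (hc : ∀ g h, c (g * h) = c g + g • c h) {a : A} (ha : ∀ h ∈ H, c h = h • a - a) :
    ∃ b : A, ∀ g, H.index • c g = g • b - b := by
  classical
  have := Fintype.ofFinite (G ⧸ H)
  let c' : G → A := fun g => c g - (g • a - a)
  have hc' : ∀ g h, c' (g * h) = c' g + g • c' h := fun g h => by
    simp only [c', hc, mul_smul, smul_sub]
    abel
  have hH : ∀ h ∈ H, c' h = 0 := fun h hh => by simp [c', ha h hh]
  let f : G ⧸ H → A := Quotient.lift c' fun g g' hg => by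
    have h0 := hH _ (QuotientGroup.leftRel_apply.1 hg)
    have h1 := hc' g (g⁻¹ * g')
    rw [mul_inv_cancel_left, h0, smul_zero, add_zero] at h1
    exact h1.symm
  have hf : ∀ (g : G) (q : G ⧸ H), f (g • q) = c' g + g • f q := fun g q => by
    induction q using QuotientGroup.induction_on with
    | H x => exact hc' g x
  have key : ∀ g, ∑ q, f q = H.index • c' g + g • ∑ q, f q := fun g => by
    calc ∑ q, f q = ∑ q, f (g • q) := (Equiv.sum_comp (MulAction.toPerm g) f).symm
      _ = _ := by
        simp only [hf, Finset.sum_add_distrib, ← Finset.smul_sum]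
        rw [Finset.sum_const, Finset.card_univ, ← Nat.card_eq_fintype_card, Subgroup.index]
  refine ⟨H.index • a - ∑ q, f q, fun g => ?_⟩
  have h1 : H.index • c g = H.index • c' g + H.index • (g • a - a) := by
    rw [← nsmul_add]
    simp [c']
  have h2 : H.index • c' g = ∑ q, f q - g • ∑ q, f q := eq_sub_of_add_eq (key g).symm
  rw [h1, h2, smul_sub, smul_sub, ← smul_comm g]
  abel

theorem exists_eq_smul_sub_of_coprime_index (H : Subgroup G) [H.FiniteIndex] {n : ℕ}
    (hn : n.Coprime H.index) {c : G → A} (hc : ∀ g h, c (g * h) = c g + g • c h)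
    (hnc : ∀ g, n • c g = 0) {a : A} (ha : ∀ h ∈ H, c h = h • a - a) :
    ∃ b : A, ∀ g, c g = g • b - b := by
  obtain ⟨b, hb⟩ := index_nsmul_crossedHom_eq H hc ha
  refine ⟨n.gcdB H.index • b, fun g => ?_⟩
  have h1 : (1 : ℤ) = n * n.gcdA H.index + H.index * n.gcdB H.index := by
    rw [← Nat.gcd_eq_gcd_ab, hn.gcd_eq_one, Nat.cast_one]
  calc c g = (1 : ℤ) • c g := (one_zsmul _).symm
    _ = n.gcdA H.index • n • c g + n.gcdB H.index • H.index • c g := by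
      rw [h1, add_zsmul, mul_comm, mul_zsmul, mul_comm, mul_zsmul, natCast_zsmul, natCast_zsmul]
    _ = _ := by rw [hnc, smul_zero, zero_add, hb, smul_sub, smul_comm g]

variable [TopologicalSpace G]

/-- A crossed homomorphism that vanishes near `1` is continuous. -/
theorem isLocallyConstant_of_crossedHom [IsTopologicalGroup G] {c : G → A}
    (hc : ∀ g h, c (g * h) = c g + g • c h) (h1 : ∀ᶠ g in nhds (1 : G), c g = 0) :
    IsLocallyConstant c := by
  rw [IsLocallyConstant.iff_eventually_eq]
  intro x
  have : Filter.Tendsto (fun y => x⁻¹ * y) (nhds x) (nhds 1) := by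
    have := (continuous_const_mul x⁻¹).tendsto x
    rwa [inv_mul_cancel] at this
  filter_upwards [this.eventually h1] with y hy
  rw [← mul_inv_cancel_left x y, hc, hy, smul_zero, add_zero]

end CrossedHom

/-! ### Corestriction from an open normal subgroup -/

section Corestriction

variable {G H Q A : Type*} [Group G] [TopologicalSpace G] [IsTopologicalGroup G] [Group H]
  [TopologicalSpace H] [Group Q] [Fintype Q] [AddCommGroup A] [DistribMulAction G A]
  [DistribMulAction H A]

/-- The corestriction of a continuous cocycle `c` from a normal subgroup with quotient `Q`, followed
by restriction, is the sum of the conjugates of `c`. The subgroup is given as the image of an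
injective open homomorphism `φ`, the conjugates are taken by representatives `s t` of the elements
`t` of `Q`, and `k t` stands for the conjugate of `h` by `s t`. -/
theorem exists_corestriction (φ : H →* G) (hφ : Function.Injective φ)
    (hφo : ∀ U ∈ nhds (1 : H), φ '' U ∈ nhds (1 : G)) (hA : ∀ (h : H) (a : A), φ h • a = h • a)
    (π : G →* Q) (hπ : ∀ g, π g = 1 ↔ g ∈ φ.range) (s : Q → G) (hs : ∀ t, π (s t) = t)
    (c : contCocycles1 H A) :
    ∃ C : contCocycles1 G A, ∀ (h : H) (k : Q → H),
      (∀ t, φ (k t) = (s t)⁻¹ * (φ h * s t)) → C.1 (φ h) = ∑ t, s t • c.1 (k t) := by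
  classical
  -- Extend `c` by zero to `G`, so that no inverse of `φ` has to be chosen.
  let e : G → A := Function.extend φ c.1 0
  have he : ∀ h, e (φ h) = c.1 h := fun h => hφ.extend_apply _ _ h
  have he_mul : ∀ g g', π g = 1 → π g' = 1 → e (g * g') = e g + g • e g' := by
    intro g g' hg hg'
    obtain ⟨h, rfl⟩ := (hπ g).1 hg
    obtain ⟨h', rfl⟩ := (hπ g').1 hg'
    rw [← map_mul, he, he, he, c.2.1, hA]
  let C : G → A := fun g => ∑ t, s (π g * t) • e ((s (π g * t))⁻¹ * (g * s t))
  -- The cocycle relation comes from reindexing the sum for `C g` by `t ↦ π g' * t`.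
  have hC : ∀ g g', C (g * g') = C g + g • C g' := by
    intro g g'
    have h1 : C g = ∑ t, s (π g * (π g' * t)) •
        e ((s (π g * (π g' * t)))⁻¹ * (g * s (π g' * t))) :=
      (Equiv.sum_comp (Equiv.mulLeft (π g'))
        fun t => s (π g * t) • e ((s (π g * t))⁻¹ * (g * s t))).symm
    rw [h1]
    simp only [C]
    rw [Finset.smul_sum, ← Finset.sum_add_distrib]
    refine Finset.sum_congr rfl fun t _ => ?_
    have h2 : (s (π (g * g') * t))⁻¹ * (g * g' * s t) =
        ((s (π g * (π g' * t)))⁻¹ * (g * s (π g' * t))) *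
          ((s (π g' * t))⁻¹ * (g' * s t)) := by
      rw [map_mul, mul_assoc (π g)]
      group
    rw [h2, he_mul _ _ (by simp [hs]) (by simp [hs]), smul_add, map_mul, mul_assoc (π g), ← mul_smul,
      mul_inv_cancel_left, mul_smul]
  have hev : ∀ᶠ g in nhds (1 : G), C g = 0 := by
    have hc0 : ∀ᶠ h in nhds (1 : H), c.1 h = 0 := by
      have := (IsLocallyConstant.iff_eventually_eq _).1 c.2.2 1
      rwa [crossedHom_one c.2.1] at this
    have he0 : ∀ᶠ g in nhds (1 : G), e g = 0 ∧ π g = 1 := by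
      refine Filter.mem_of_superset (hφo _ hc0) ?_
      rintro _ ⟨h, hh, rfl⟩
      exact ⟨(he h).trans hh, (hπ _).2 ⟨h, rfl⟩⟩
    have hconj : ∀ᶠ g in nhds (1 : G), ∀ t : Q, e ((s t)⁻¹ * (g * s t)) = 0 := by
      rw [Filter.eventually_all]
      intro t
      have : Filter.Tendsto (fun g => (s t)⁻¹ * (g * s t)) (nhds 1) (nhds 1) := by
        have h : Continuous fun g => (s t)⁻¹ * (g * s t) := by fun_prop
        simpa using h.tendsto 1
      exact (this.eventually he0).mono fun g hg => hg.1
    filter_upwards [he0, hconj] with g hg hg'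
    simp [C, hg.2, hg']
  refine ⟨⟨C, hC, isLocallyConstant_of_crossedHom hC hev⟩, fun h k hk => ?_⟩
  have hh : π (φ h) = 1 := (hπ _).2 ⟨h, rfl⟩
  change C (φ h) = _
  simp only [C, hh, one_mul, ← hk, he]

end Corestriction

/-! ### Galois groups in a tower of fields -/

section Galois

variable {L M Ω Ω' : Type*} [Field L] [Field M] [Field Ω] [Field Ω'] [Algebra L Ω] [Algebra L M]
  [Algebra M Ω'] [Algebra L Ω'] [IsScalarTower L M Ω']

/-- Two embeddings of a normal extension differ by an automorphism. -/
theorem exists_comp_eq_of_normal [Normal L Ω] (ι ι' : Ω →ₐ[L] Ω') :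
    ∃ σ : Ω ≃ₐ[L] Ω, ∀ x, ι' x = ι (σ x) := by
  let : Algebra Ω Ω' := ι.toRingHom.toAlgebra
  have : IsScalarTower L Ω Ω' := IsScalarTower.of_algebraMap_eq fun x => (ι.commutes x).symm
  refine ⟨Normal.algHomEquivAut L Ω' Ω ι', fun x => ?_⟩
  exact DFunLike.congr_fun ((Normal.algHomEquivAut L Ω' Ω).symm_apply_apply ι').symm x

variable {K F : Type*} [Field K] [Field F] [Algebra K F] [Algebra K Ω] [Algebra F Ω]
  [IsScalarTower K F Ω]

theorem galRes_id_apply [Normal K Ω] (τ : Ω ≃ₐ[F] Ω) (x : Ω) :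
    galRes (AlgHom.id K Ω) τ x = τ x :=
  galRes_commutes (AlgHom.id K Ω) τ x

theorem galRes_id_injective [Normal K Ω] :
    Function.Injective (galRes (M := F) (AlgHom.id K Ω)) := fun τ τ' h => by
  ext x
  rw [← galRes_id_apply (K := K), h, galRes_id_apply]

theorem restrictNormalHom_eq_one_iff [Normal K F] (g : Ω ≃ₐ[K] Ω) :
    AlgEquiv.restrictNormalHom F g = 1 ↔ ∀ x : F, g (algebraMap F Ω x) = algebraMap F Ω x := by
  have h := AlgEquiv.restrictNormal_commutes g F
  constructor
  · intro hg x
    rw [← h x]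
    exact congrArg _ (DFunLike.congr_fun hg x)
  · intro hg
    ext x
    exact (algebraMap F Ω).injective ((h x).trans (hg x))

theorem restrictNormalHom_eq_one_iff_mem_range [Normal K F] [Normal K Ω] (g : Ω ≃ₐ[K] Ω) :
    AlgEquiv.restrictNormalHom F g = 1 ↔ g ∈ (galRes (M := F) (AlgHom.id K Ω)).range := by
  rw [restrictNormalHom_eq_one_iff]
  constructor
  · intro hg
    refine ⟨AlgEquiv.ofRingEquiv (f := g.toRingEquiv) hg, ?_⟩
    ext x
    exact galRes_id_apply _ x
  · rintro ⟨τ, rfl⟩ x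
    rw [galRes_id_apply, τ.commutes]

/-- For `F/K` finite, `Gal(Ω/F)` is open in `Gal(Ω/K)`. -/
theorem galRes_id_image_mem_nhds_one [FiniteDimensional K F] [Normal K Ω]
    {U : Set (Ω ≃ₐ[F] Ω)} (hU : U ∈ nhds 1) :
    galRes (AlgHom.id K Ω) '' U ∈ nhds (1 : Ω ≃ₐ[K] Ω) := by
  obtain ⟨E, hE, hEU⟩ := (krullTopology_mem_nhds_one_iff F Ω U).1 hU
  have : FiniteDimensional K E := FiniteDimensional.trans K F E
  refine (krullTopology_mem_nhds_one_iff K Ω _).2 ⟨E.restrictScalars K, this, fun g hg => ?_⟩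
  have hg' : ∀ x ∈ E, g x = x := (IntermediateField.mem_fixingSubgroup_iff _ g).1 hg
  refine ⟨AlgEquiv.ofRingEquiv (f := g.toRingEquiv) fun x => hg' _ (E.algebraMap_mem x),
    hEU ((IntermediateField.mem_fixingSubgroup_iff _ _).2 fun x hx => hg' x hx), ?_⟩
  ext x
  exact galRes_id_apply _ x

end Galois

/-! ### Galois cohomology of torsion points -/

namespace WeierstrassCurve

noncomputable section

open scoped Classical WeierstrassCurve.Affine

variable {K : Type*} [Field K] (W : WeierstrassCurve K)

section General

variable {L Ω : Type*} [Field L] [Field Ω] [Algebra K L] [Algebra K Ω] [Algebra L Ω]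
  [IsScalarTower K L Ω]

theorem contH1_mk_eq_iff {n : ℕ} {c d : contCocycles1 (Ω ≃ₐ[L] Ω) (W.nTorsion Ω n)} :
    ContH1.mk c = ContH1.mk d ↔
      ∃ b : W.nTorsion Ω n, ∀ g, d.1 g = c.1 g + (g • b - b) := by
  refine QuotientAddGroup.eq.trans (exists_congr fun b => forall_congr' fun g => ?_)
  change -(c.1 g) + d.1 g = _ ↔ _
  rw [neg_add_eq_iff_eq_add]

theorem nsmul_nTorsion {n : ℕ} (P : W.nTorsion Ω n) : n • P = 0 :=
  Subtype.ext ((W.mem_nTorsion_iff).1 P.2)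

theorem nsmul_galH1 {n : ℕ} (x : W.galH1 L Ω n) : n • x = 0 := by
  induction x using QuotientAddGroup.induction_on with
  | H c =>
  have : n • c = 0 := Subtype.ext (funext fun g => W.nsmul_nTorsion (c.1 g))
  rw [← QuotientAddGroup.mk_nsmul, this, QuotientAddGroup.mk_zero]

theorem exists_baseChange_eq_of_fixed [IsGalois L Ω] {P : (W⁄Ω).Point}
    (hP : ∀ σ : Ω ≃ₐ[L] Ω, σ • P = P) :
    ∃ P₀ : (W⁄L).Point, Affine.Point.baseChange (W' := W) L Ω P₀ = P := by
  rcases P with _ | ⟨x, y, h⟩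
  · exact ⟨0, rfl⟩
  · have hfix : ∀ σ : Ω ≃ₐ[L] Ω, σ x = x ∧ σ y = y := fun σ => by
      have := hP σ
      rw [galois_smul_point_def, Affine.Point.map_some] at this
      simpa using this
    obtain ⟨x₀, rfl⟩ := (InfiniteGalois.mem_range_algebraMap_iff_fixed x).2 fun σ => (hfix σ).1
    obtain ⟨y₀, rfl⟩ := (InfiniteGalois.mem_range_algebraMap_iff_fixed y).2 fun σ => (hfix σ).2
    exact ⟨.some x₀ y₀ ((Affine.baseChange_nonsingular (W := W)
      (f := Algebra.ofId L Ω) (Algebra.ofId L Ω).injective ..).1 h), rfl⟩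

variable {Ω' : Type*} [Field Ω'] [Algebra K Ω'] [Algebra L Ω'] [IsScalarTower K L Ω']

theorem galRes_smul_map {M : Type*} [Field M] [Algebra K M] [Algebra L M] [Algebra M Ω']
    [IsScalarTower L M Ω'] [IsScalarTower K M Ω'] [Normal L Ω] (ι : Ω →ₐ[L] Ω')
    (τ : Ω' ≃ₐ[M] Ω') (P : (W⁄Ω).Point) :
    Affine.Point.map (W' := W) ι (galRes ι τ • P) = τ • Affine.Point.map (W' := W) ι P := by
  rcases P with _ | ⟨x, y, h⟩
  · rfl
  · simp only [galois_smul_point_def, Affine.Point.map_some, Affine.Point.some.injEq]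
    exact ⟨galRes_commutes ι τ x, galRes_commutes ι τ y⟩

theorem nTorsionMap_galRes_smul {M : Type*} [Field M] [Algebra K M] [Algebra L M] [Algebra M Ω']
    [IsScalarTower L M Ω'] [IsScalarTower K M Ω'] [Normal L Ω] {n : ℕ} (ι : Ω →ₐ[L] Ω')
    (τ : Ω' ≃ₐ[M] Ω') (P : W.nTorsion Ω n) :
    W.nTorsionMap n ι (galRes ι τ • P) = τ • W.nTorsionMap n ι P :=
  Subtype.ext (by exact W.galRes_smul_map ι τ P.1)

theorem nTorsionMap_id {n : ℕ} (P : W.nTorsion Ω n) : W.nTorsionMap n (AlgHom.id L Ω) P = P :=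
  Subtype.ext (by rcases P with ⟨_ | _, _⟩ <;> rfl)

/-- The restriction map does not depend on the embedding of algebraic closures. -/
theorem galH1Res_eq {M : Type*} [Field M] [Algebra K M] [Algebra L M] [Algebra M Ω']
    [IsScalarTower L M Ω'] [IsScalarTower K M Ω'] [Normal L Ω] [Algebra.IsAlgebraic M Ω']
    (n : ℕ) (ι ι' : Ω →ₐ[L] Ω') : W.galH1Res M n ι = W.galH1Res M n ι' := by
  obtain ⟨σ, hσ⟩ := exists_comp_eq_of_normal ι ι'
  refine AddMonoidHom.ext fun x => ?_
  induction x using QuotientAddGroup.induction_on with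
  | H c =>
  refine W.contH1_mk_eq_iff.2 ⟨W.nTorsionMap n ι (c.1 σ), fun τ => ?_⟩
  have hmap : ∀ P : W.nTorsion Ω n, W.nTorsionMap n ι' P = W.nTorsionMap n ι (σ • P) := by
    rintro ⟨P, hP⟩
    refine Subtype.ext ?_
    change Affine.Point.map (W' := W) ι' P =
      Affine.Point.map (W' := W) ι (Affine.Point.map (W' := W) (σ : Ω →ₐ[L] Ω) P)
    rcases P with _ | ⟨x, y, h⟩
    · rfl
    · simp only [Affine.Point.map_some, Affine.Point.some.injEq]
      exact ⟨hσ x, hσ y⟩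
  have hres : galRes ι' τ = σ⁻¹ * (galRes ι τ * σ) := by
    ext x
    refine ι'.injective ?_
    change ι' _ = ι' _
    rw [galRes_commutes, hσ, hσ]
    change _ = ι (σ (σ.symm (galRes ι τ (σ x))))
    rw [AlgEquiv.apply_symm_apply, galRes_commutes]
  change W.nTorsionMap n ι' (c.1 (galRes ι' τ)) = W.nTorsionMap n ι (c.1 (galRes ι τ)) + _
  rw [hmap, hres, crossedHom_conj_sub c.2.1, map_add, map_sub]
  congr 2
  exact W.nTorsionMap_galRes_smul ι τ _

/-- Kummer classes are functorial. -/
theorem galH1Res_mem_kummerImage {M : Type*} [Field M] [Algebra K M] [Algebra L M] [Algebra M Ω']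
    [IsScalarTower L M Ω'] [IsScalarTower K M Ω'] [IsScalarTower K L M] [Normal L Ω]
    [Algebra.IsAlgebraic M Ω'] {n : ℕ} (ι : Ω →ₐ[L] Ω') {x : W.galH1 L Ω n}
    (hx : x ∈ W.kummerImage L Ω n) : W.galH1Res M n ι x ∈ W.kummerImage M Ω' n := by
  obtain ⟨P, Q, c, hQ, hc, rfl⟩ := hx
  let c' : contCocycles1 (Ω' ≃ₐ[M] Ω') (W.nTorsion Ω' n) :=
    contCocycles1Map (galRes ι) (galRes_continuous ι) (W.nTorsionMap n ι)
      (W.nTorsionMap_galRes_smul ι) c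
  refine ⟨Affine.Point.baseChange (W' := W) L M P, Affine.Point.map (W' := W) ι Q, c',
    ?_, fun τ => ?_, rfl⟩
  · rw [← map_nsmul, hQ, Affine.Point.map_baseChange]
    rcases P with _ | ⟨x, y, h⟩
    · rfl
    · simp only [Affine.Point.map_some, Affine.Point.some.injEq]
      exact ⟨IsScalarTower.algebraMap_apply L M Ω' x, IsScalarTower.algebraMap_apply L M Ω' y⟩
  · change Affine.Point.map (W' := W) ι (c.1 (galRes ι τ)).1 = _
    rw [hc, map_sub, galRes_smul_map]

end General

/-! ### Restriction to a finite Galois extension -/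

section Global

variable {F Ω : Type*} [Field F] [Field Ω] [Algebra K F] [Algebra K Ω] [Algebra F Ω]
  [IsScalarTower K F Ω] [Normal K Ω]

theorem galRes_id_smul {n : ℕ} (τ : Ω ≃ₐ[F] Ω) (P : W.nTorsion Ω n) :
    galRes (AlgHom.id K Ω) τ • P = τ • P := by
  simpa only [nTorsionMap_id] using W.nTorsionMap_galRes_smul (AlgHom.id K Ω) τ P

theorem galRes_id_galConj [Normal K F] (σ : Ω ≃ₐ[K] Ω) (τ : Ω ≃ₐ[F] Ω) :
    galRes (AlgHom.id K Ω) (galConj σ τ) = σ⁻¹ * (galRes (AlgHom.id K Ω) τ * σ) := by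
  ext x
  rw [galRes_id_apply]
  change σ.symm (τ (σ x)) = σ.symm (galRes (AlgHom.id K Ω) τ (σ x))
  rw [galRes_id_apply]

/-- The compatibility that makes `galConj σ` and the action of `σ` act on cocycles. -/
theorem smul_galConj_smul [Normal K F] {n : ℕ} (σ : Ω ≃ₐ[K] Ω) (τ : Ω ≃ₐ[F] Ω)
    (P : W.nTorsion Ω n) : σ • galConj σ τ • P = τ • σ • P := by
  rw [← W.galRes_id_smul (galConj σ τ), ← W.galRes_id_smul τ, galRes_id_galConj, smul_smul,
    mul_inv_cancel_left, mul_smul]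

variable [Algebra.IsAlgebraic F Ω]

theorem galH1Res_id_mk {n : ℕ} (c : contCocycles1 (Ω ≃ₐ[K] Ω) (W.nTorsion Ω n))
    (d : contCocycles1 (Ω ≃ₐ[F] Ω) (W.nTorsion Ω n))
    (h : ∀ τ, c.1 (galRes (AlgHom.id K Ω) τ) = d.1 τ) :
    W.galH1Res F n (AlgHom.id K Ω) (ContH1.mk c) = ContH1.mk d :=
  congrArg ContH1.mk (Subtype.ext (funext fun τ => (W.nTorsionMap_id _).trans (h τ)))

theorem galH1Res_id_injective [FiniteDimensional K F] [IsGalois K F] {n : ℕ}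
    (hd : n.Coprime (Module.finrank K F)) :
    Function.Injective (W.galH1Res F n (AlgHom.id K Ω)) := by
  rw [injective_iff_map_eq_zero]
  intro x hx
  induction x using QuotientAddGroup.induction_on with
  | H c =>
  obtain ⟨b, hb⟩ := W.contH1_mk_eq_iff.1 (hx.trans (map_zero ContH1.mk).symm).symm
  let N : Subgroup (Ω ≃ₐ[K] Ω) := (AlgEquiv.restrictNormalHom F).ker
  have hN : N.index = Module.finrank K F := by
    rw [Subgroup.index_ker, MonoidHom.range_eq_top.2 (AlgEquiv.restrictNormalHom_surjective Ω),
      Subgroup.card_top, IsGalois.card_aut_eq_finrank]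
  have : N.FiniteIndex := ⟨by rw [hN]; exact Module.finrank_pos.ne'⟩
  obtain ⟨a, ha⟩ := exists_eq_smul_sub_of_coprime_index N (hN ▸ hd) c.2.1
    (fun g => W.nsmul_nTorsion _) (a := b) fun g hg => by
      obtain ⟨τ, rfl⟩ := (restrictNormalHom_eq_one_iff_mem_range g).1 hg
      rw [galRes_id_smul]
      exact (W.nTorsionMap_id _).symm.trans ((hb τ).trans (zero_add _))
  refine W.contH1_mk_eq_iff.2 ⟨-a, fun g => ?_⟩
  rw [ha g, smul_neg]
  change (0 : W.nTorsion Ω n) = _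
  abel

/-- Restricted classes are invariant under `Gal(F/K)`. -/
theorem smul_galH1Res_id [Normal K F] (n : ℕ) (x : W.galH1 K Ω n) (σ : F ≃ₐ[K] F) :
    σ • W.galH1Res F n (AlgHom.id K Ω) x = W.galH1Res F n (AlgHom.id K Ω) x := by
  induction x using QuotientAddGroup.induction_on with
  | H c =>
  symm
  refine W.contH1_mk_eq_iff.2 ⟨c.1 (σ.liftNormal Ω), fun τ => ?_⟩
  change σ.liftNormal Ω • W.nTorsionMap n (AlgHom.id K Ω)
      (c.1 (galRes (AlgHom.id K Ω) (galConj (σ.liftNormal Ω) τ))) =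
    W.nTorsionMap n (AlgHom.id K Ω) (c.1 (galRes (AlgHom.id K Ω) τ)) + _
  rw [nTorsionMap_id, nTorsionMap_id, galRes_id_galConj, crossedHom_conj_sub c.2.1, galRes_id_smul]

/-- `res ∘ cor` is the norm of `Gal(F/K)`. -/
theorem exists_galH1Res_eq_sum_smul [FiniteDimensional K F] [IsGalois K F]
    [Fintype (F ≃ₐ[K] F)] {n : ℕ} (y : W.galH1 F Ω n) :
    ∃ x : W.galH1 K Ω n,
      W.galH1Res F n (AlgHom.id K Ω) x = ∑ σ : F ≃ₐ[K] F, σ • y := by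
  induction y using QuotientAddGroup.induction_on with
  | H c =>
  obtain ⟨C, hC⟩ := exists_corestriction (A := W.nTorsion Ω n)
    (galRes (M := F) (AlgHom.id K Ω)) galRes_id_injective
    (fun U => galRes_id_image_mem_nhds_one) W.galRes_id_smul (AlgEquiv.restrictNormalHom F)
    restrictNormalHom_eq_one_iff_mem_range (fun t => t.liftNormal Ω)
    (fun t => t.restrict_liftNormal Ω) c
  let conj (σ : F ≃ₐ[K] F) : contCocycles1 (Ω ≃ₐ[F] Ω) (W.nTorsion Ω n) :=
    contCocycles1Map (galConj (σ.liftNormal Ω)) (galConj_continuous _)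
      (DistribSMul.toAddMonoidHom (W.nTorsion Ω n) (σ.liftNormal Ω))
      (W.smul_galConj_smul (σ.liftNormal Ω)) c
  have hconj : ∀ σ : F ≃ₐ[K] F, ContH1.mk (conj σ) = σ • (ContH1.mk c : W.galH1 F Ω n) :=
    fun σ => rfl
  refine ⟨ContH1.mk C, ?_⟩
  rw [W.galH1Res_id_mk C (∑ σ, conj σ), map_sum]
  · exact Finset.sum_congr rfl fun σ _ => hconj σ
  · intro τ
    rw [AddSubgroup.val_finsetSum, Finset.sum_apply]
    exact hC τ (fun σ => galConj (σ.liftNormal Ω) τ) fun σ => galRes_id_galConj _ _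

theorem exists_galH1Res_eq_of_fixed [FiniteDimensional K F] [IsGalois K F] {n : ℕ}
    (hd : n.Coprime (Module.finrank K F)) (y : W.galH1 F Ω n)
    (hy : ∀ σ : F ≃ₐ[K] F, σ • y = y) :
    ∃ x : W.galH1 K Ω n, W.galH1Res F n (AlgHom.id K Ω) x = y := by
  have := Fintype.ofFinite (F ≃ₐ[K] F)
  obtain ⟨x, hx⟩ := W.exists_galH1Res_eq_sum_smul y
  rw [Finset.sum_congr rfl fun σ _ => hy σ, Finset.sum_const, Finset.card_univ,
    ← Nat.card_eq_fintype_card, IsGalois.card_aut_eq_finrank] at hx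
  -- A Bézout coefficient of `[F : K]` inverts the degree on the `n`-torsion group `H¹(F, E[n])`.
  have h1 : (1 : ℤ) = n * n.gcdA (Module.finrank K F) +
      Module.finrank K F * n.gcdB (Module.finrank K F) := by
    rw [← Nat.gcd_eq_gcd_ab, hd.gcd_eq_one, Nat.cast_one]
  refine ⟨n.gcdB (Module.finrank K F) • x, ?_⟩
  rw [map_zsmul, hx]
  nth_rewrite 2 [← one_zsmul y]
  rw [h1, add_zsmul, mul_comm, mul_zsmul, mul_comm, mul_zsmul, natCast_zsmul, natCast_zsmul,
    nsmul_galH1, smul_zero, zero_add]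

end Global

end

end WeierstrassCurve

/-! ### The local conditions along an extension of local fields

Here `m/k` is an extension of fields that contains `F/K`, and `Ωm`, `Ωk` are algebraic closures. -/

section LocalGalois

variable {K F Ω k Ωk m Ωm : Type*} [Field K] [Field F] [Field Ω] [Field k] [Field Ωk] [Field m]
  [Field Ωm] [Algebra K Ω] [Algebra F Ω] [Algebra K Ωk] [Algebra k Ωk] [Algebra F Ωm]
  [Algebra k Ωm]

theorem exists_algHom_comp_eq [Algebra K F] [IsScalarTower K F Ω] [Normal K Ω] [Algebra K k]
    [IsScalarTower K k Ωk] [Algebra K Ωm] [IsScalarTower K F Ωm] [IsScalarTower K k Ωm]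
    [IsAlgClosed Ωk] (j : Ω →ₐ[F] Ωm) (θ : Ωk →ₐ[k] Ωm) :
    ∃ ι : Ω →ₐ[K] Ωk, ∀ x, θ (ι x) = j x := by
  have : Algebra.IsAlgebraic K Ω := Normal.toIsAlgebraic
  let ι : Ω →ₐ[K] Ωk := IsAlgClosed.lift
  obtain ⟨σ, hσ⟩ := exists_comp_eq_of_normal ((θ.restrictScalars K).comp ι) (j.restrictScalars K)
  exact ⟨ι.comp (σ : Ω →ₐ[K] Ω), fun x => (hσ x).symm⟩

/-- If `m = k(F)`, an automorphism of `Ωk/k` that fixes `F` comes from `Gal(Ωm/m)`. -/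
theorem exists_galRes_eq_of_fixes [Normal k Ωk] [Algebra F m] [Algebra k m] [Algebra m Ωm]
    [IsScalarTower F m Ωm] [IsScalarTower k m Ωm]
    (hgen : Algebra.adjoin k (Set.range (algebraMap F m)) = ⊤) {j : Ω →ₐ[F] Ωm}
    {θ : Ωk ≃ₐ[k] Ωm} {ι : Ω →ₐ[K] Ωk} (h : ∀ x, θ (ι x) = j x) (σ : Ωk ≃ₐ[k] Ωk)
    (hσ : ∀ x : F, σ (ι (algebraMap F Ω x)) = ι (algebraMap F Ω x)) :
    ∃ τ : Ωm ≃ₐ[m] Ωm, galRes (θ : Ωk →ₐ[k] Ωm) τ = σ := by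
  let ρ : Ωm ≃ₐ[k] Ωm := (θ.symm.trans σ).trans θ
  have hρ : (ρ : Ωm →ₐ[k] Ωm).comp (IsScalarTower.toAlgHom k m Ωm) =
      IsScalarTower.toAlgHom k m Ωm := by
    refine AlgHom.ext_of_adjoin_eq_top hgen ?_
    rintro _ ⟨x, rfl⟩
    have h1 : algebraMap m Ωm (algebraMap F m x) = θ (ι (algebraMap F Ω x)) := by
      rw [h, j.commutes, ← IsScalarTower.algebraMap_apply]
    change θ (σ (θ.symm (algebraMap m Ωm (algebraMap F m x)))) =
      algebraMap m Ωm (algebraMap F m x)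
    rw [h1, θ.symm_apply_apply, hσ]
  refine ⟨AlgEquiv.ofRingEquiv (f := ρ.toRingEquiv) fun y => DFunLike.congr_fun hρ y, ?_⟩
  ext x
  refine θ.injective ((galRes_commutes (θ : Ωk →ₐ[k] Ωm) _ x).trans ?_)
  change θ (σ (θ.symm (θ x))) = _
  rw [θ.symm_apply_apply]

end LocalGalois

namespace WeierstrassCurve

noncomputable section

open scoped Classical WeierstrassCurve.Affine

variable {K : Type*} [Field K] (W : WeierstrassCurve K)

section Local

variable {F Ω k Ωk m Ωm : Type*} [Field F] [Field Ω] [Field k] [Field Ωk] [Field m] [Field Ωm]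
  [Algebra K F] [Algebra K Ω] [Algebra F Ω] [IsScalarTower K F Ω] [Normal K Ω]
  [Algebra K k] [Algebra K Ωk] [Algebra k Ωk] [IsScalarTower K k Ωk]
  [Algebra K m] [Algebra F m] [Algebra k m] [Algebra K Ωm] [Algebra F Ωm] [Algebra k Ωm]
  [Algebra m Ωm] [IsScalarTower K m Ωm] [IsScalarTower F m Ωm] [IsScalarTower k m Ωm]
  [IsScalarTower K F Ωm] [IsScalarTower K k Ωm] [Algebra.IsAlgebraic m Ωm]

variable [Normal F Ω] [Normal k Ωk]

theorem galH1Res_galH1Res_id {n : ℕ} {j : Ω →ₐ[F] Ωm} {θ : Ωk →ₐ[k] Ωm} {ι : Ω →ₐ[K] Ωk}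
    (h : ∀ x, θ (ι x) = j x) (x : W.galH1 K Ω n) :
    W.galH1Res m n j (W.galH1Res F n (AlgHom.id K Ω) x) =
      W.galH1Res m n θ (W.galH1Res k n ι x) := by
  induction x using QuotientAddGroup.induction_on with
  | H c =>
  refine congrArg ContH1.mk (Subtype.ext (funext fun τ => ?_))
  change W.nTorsionMap n j (W.nTorsionMap n (AlgHom.id K Ω)
    (c.1 (galRes (AlgHom.id K Ω) (galRes j τ)))) =
    W.nTorsionMap n θ (W.nTorsionMap n ι (c.1 (galRes ι (galRes θ τ))))
  have h1 : galRes (AlgHom.id K Ω) (galRes j τ) = galRes ι (galRes θ τ) := by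
    ext x
    refine j.injective ?_
    change j _ = j _
    rw [galRes_id_apply, galRes_commutes, ← h, ← h, galRes_commutes, galRes_commutes]
  rw [h1]
  rcases c.1 (galRes ι (galRes θ τ)) with ⟨_ | ⟨x, y, hxy⟩, hP⟩
  · rfl
  · refine Subtype.ext ?_
    simp only [nTorsionMap, AddMonoidHom.coe_mk, ZeroHom.coe_mk, Affine.Point.map_some,
      Affine.Point.some.injEq]
    exact ⟨(h x).symm, (h y).symm⟩

theorem galH1Res_galH1Res_id_mem_kummerImage [IsScalarTower K k m] [IsAlgClosed Ωk]
    [IsAlgClosed Ωm] {n : ℕ} {x : W.galH1 K Ω n}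
    (hx : ∀ ι : Ω →ₐ[K] Ωk, W.galH1Res k n ι x ∈ W.kummerImage k Ωk n) (j : Ω →ₐ[F] Ωm) :
    W.galH1Res m n j (W.galH1Res F n (AlgHom.id K Ω) x) ∈ W.kummerImage m Ωm n := by
  let θ : Ωk →ₐ[k] Ωm := IsAlgClosed.lift
  obtain ⟨ι, hι⟩ := exists_algHom_comp_eq (K := K) j θ
  rw [W.galH1Res_galH1Res_id hι]
  exact W.galH1Res_mem_kummerImage θ (hx ι)

/-- Descent of the Kummer condition from `m` to `k`. As a class with values in `E(Ωk)`, the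
restriction of `x` dies on the subgroup of `Gal(Ωk/k)` that fixes `F`. The index of this subgroup
divides `[F : K]`, as its quotient embeds in `Gal(F/K)`, so the class dies on `Gal(Ωk/k)`. -/
theorem galH1Res_mem_kummerImage_of_coprime [FiniteDimensional K F] [IsGalois K F]
    [IsGalois k Ωk] [IsAlgClosed Ωk] [IsAlgClosed Ωm] [Algebra.IsAlgebraic k m] {n : ℕ}
    (hd : n.Coprime (Module.finrank K F))
    (hgen : Algebra.adjoin k (Set.range (algebraMap F m)) = ⊤) {x : W.galH1 K Ω n}
    (hx : ∀ j : Ω →ₐ[F] Ωm,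
      W.galH1Res m n j (W.galH1Res F n (AlgHom.id K Ω) x) ∈ W.kummerImage m Ωm n)
    (ι' : Ω →ₐ[K] Ωk) : W.galH1Res k n ι' x ∈ W.kummerImage k Ωk n := by
  have : Algebra.IsAlgebraic k Ωm := Algebra.IsAlgebraic.trans k m Ωm
  have : IsAlgClosure k Ωm := ⟨inferInstance, inferInstance⟩
  have : IsAlgClosure k Ωk := ⟨inferInstance, inferInstance⟩
  let θ : Ωk ≃ₐ[k] Ωm := IsAlgClosure.equiv k Ωk Ωm
  let j : Ω →ₐ[F] Ωm := IsAlgClosed.lift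
  obtain ⟨ι, hι⟩ := exists_algHom_comp_eq (K := K) j (θ : Ωk →ₐ[k] Ωm)
  -- The embedding `ι'` need not be compatible with an `F`-embedding into `Ωm`, but `ι` is.
  rw [W.galH1Res_eq n ι' ι]
  have hxj := hx j
  rw [W.galH1Res_galH1Res_id hι] at hxj
  clear hx
  induction x using QuotientAddGroup.induction_on with
  | H c₀ =>
  let c : contCocycles1 (Ωk ≃ₐ[k] Ωk) (W.nTorsion Ωk n) :=
    contCocycles1Map (galRes ι) (galRes_continuous ι) (W.nTorsionMap n ι)
      (W.nTorsionMap_galRes_smul ι) c₀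
  obtain ⟨P, Q, d, -, hQd, hmk⟩ := hxj
  obtain ⟨b, hb⟩ := W.contH1_mk_eq_iff.1 hmk
  let f : (W⁄Ωk).Point →+ (W⁄Ωm).Point := Affine.Point.map (W' := W) (θ : Ωk →ₐ[k] Ωm)
  let g : (W⁄Ωm).Point →+ (W⁄Ωk).Point := Affine.Point.map (W' := W) (θ.symm : Ωm →ₐ[k] Ωk)
  have hfg : ∀ R, f (g R) = R := fun R => by
    rcases R with _ | ⟨x, y, hxy⟩
    · rfl
    · simp only [f, g, Affine.Point.map_some, Affine.Point.some.injEq]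
      exact ⟨θ.apply_symm_apply x, θ.apply_symm_apply y⟩
  have hf : Function.Injective f := Affine.Point.map_injective _
  have hτ : ∀ τ : Ωm ≃ₐ[m] Ωm, f (c.1 (galRes (θ : Ωk →ₐ[k] Ωm) τ)).1 =
      τ • (Q + b.1) - (Q + b.1) := fun τ => by
    have h1 : f (c.1 (galRes (θ : Ωk →ₐ[k] Ωm) τ)).1 = (d.1 τ).1 + (τ • b.1 - b.1) :=
      congrArg Subtype.val (hb τ)
    rw [h1, hQd, smul_add]
    abel
  let N : Subgroup (Ωk ≃ₐ[k] Ωk) := ((AlgEquiv.restrictNormalHom F).comp (galRes ι)).ker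
  have hN : N.index ∣ Module.finrank K F := by
    rw [Subgroup.index_ker, ← IsGalois.card_aut_eq_finrank K F]
    exact Subgroup.card_subgroup_dvd_card _
  have : N.FiniteIndex := ⟨(Nat.pos_of_dvd_of_pos hN Module.finrank_pos).ne'⟩
  obtain ⟨R, hR⟩ := exists_eq_smul_sub_of_coprime_index N (hd.coprime_dvd_right hN)
    (c := fun σ => (c.1 σ).1) (a := g (Q + b.1))
    (fun σ τ => congrArg Subtype.val (c.2.1 σ τ))
    (fun σ => (W.mem_nTorsion_iff).1 (c.1 σ).2) fun σ hσ => by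
      have hfix := (restrictNormalHom_eq_one_iff _).1 (MonoidHom.mem_ker.1 hσ)
      obtain ⟨τ, rfl⟩ := exists_galRes_eq_of_fixes hgen hι σ fun x => by
        rw [← galRes_commutes, hfix]
      apply hf
      rw [hτ, map_sub, W.galRes_smul_map, hfg]
  -- `n • R` is Galois invariant since `n` kills the differences `σ • R - R`.
  obtain ⟨P₀, hP₀⟩ := W.exists_baseChange_eq_of_fixed (L := k) (P := n • R) fun σ => by
    have h1 : σ • R = R + (c.1 σ).1 := by rw [hR]; abel
    rw [smul_comm σ, h1, nsmul_add, (W.mem_nTorsion_iff).1 (c.1 σ).2, add_zero]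
  exact ⟨P₀, R, c, hP₀.symm, hR, rfl⟩

end Local

end

end WeierstrassCurve

/-! ### Completions of number fields -/

section Completion

open NumberField IsDedekindDomain
open scoped TensorProduct NumberField.LiesOver Valued

variable {K F : Type*} [Field K] [Field F] [NumberField K] [NumberField F] [Algebra K F]

/-- The subspace spanned over the complete field `k` by the image of `F` is finite dimensional, hence
closed in `m`, and it is dense. -/
theorem finite_and_adjoin_range_eq_top_of_denseRange {K F k m : Type*} [Field K] [Field F]
    [Algebra K F] [FiniteDimensional K F] [NontriviallyNormedField k] [CompleteSpace k] [Field m]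
    [TopologicalSpace m] [IsTopologicalRing m] [T2Space m] [Algebra K k] [Algebra F m]
    [Algebra K m] [IsScalarTower K F m] [Algebra k m] [IsScalarTower K k m]
    (hc : Continuous (algebraMap k m)) (hF : DenseRange (algebraMap F m)) :
    Module.Finite k m ∧ Algebra.adjoin k (Set.range (algebraMap F m)) = ⊤ := by
  have : ContinuousSMul k m := by
    refine ⟨?_⟩
    simp_rw [Algebra.smul_def]
    fun_prop
  let Φ : TensorProduct K k F →ₐ[k] m := Algebra.TensorProduct.lift (Algebra.ofId k m)
    (IsScalarTower.toAlgHom K F m) fun _ _ => mul_comm _ _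
  have hΦ : ∀ a x, Φ (a ⊗ₜ x) = algebraMap k m a * algebraMap F m x :=
    Algebra.TensorProduct.lift_tmul _ _ _
  have hsurj : Function.Surjective Φ.toLinearMap := by
    rw [← Set.range_eq_univ, ← LinearMap.coe_range,
      ← (LinearMap.range Φ.toLinearMap).closed_of_finiteDimensional.closure_eq]
    refine (Dense.mono ?_ hF).closure_eq
    rintro _ ⟨x, rfl⟩
    exact ⟨1 ⊗ₜ x, by simpa using hΦ 1 x⟩
  refine ⟨.of_surjective Φ.toLinearMap hsurj, top_unique fun y _ => ?_⟩
  obtain ⟨t, rfl⟩ := hsurj y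
  induction t using TensorProduct.induction_on with
  | zero => simp
  | add s t hs ht => rw [map_add]; exact add_mem (hs trivial) (ht trivial)
  | tmul a x =>
    change Φ (a ⊗ₜ x) ∈ _
    rw [hΦ, ← Algebra.smul_def]
    exact Subalgebra.smul_mem _ (Algebra.subset_adjoin (Set.mem_range_self x)) a

/-- For `w` above `v`, the completion `F_w` is a finite extension of `K_v` generated by `F`. The
algebra structure is part of the conclusion, as Mathlib has no instance for it. -/
theorem exists_adicCompletion_algebra (v : HeightOneSpectrum (𝓞 K)) (w : HeightOneSpectrum (𝓞 F))
    [w.asIdeal.LiesOver v.asIdeal] :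
    ∃ _ : Algebra (v.adicCompletion K) (w.adicCompletion F),
      IsScalarTower K (v.adicCompletion K) (w.adicCompletion F) ∧
      Module.Finite (v.adicCompletion K) (w.adicCompletion F) ∧
      Algebra.adjoin (v.adicCompletion K)
        (Set.range (algebraMap F (w.adicCompletion F))) = ⊤ := by
  let f₀ : WithVal (v.valuation K) →+* WithVal (w.valuation F) := algebraMap _ _
  have hf₀ : UniformContinuous f₀ :=
    HeightOneSpectrum.uniformContinuous_algebraMap_liesOver K F v w
  let f : v.adicCompletion K →+* w.adicCompletion F :=
    ((HeightOneSpectrum.adicCompletion.equiv F w).symm.toRingHom.comp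
      (UniformSpace.Completion.mapRingHom f₀ hf₀.continuous)).comp
        (HeightOneSpectrum.adicCompletion.equiv K v).toRingHom
  have hf : Continuous f :=
    (HeightOneSpectrum.adicCompletion.continuous_ofCompletion F w).comp
      (UniformSpace.Completion.continuous_map.comp
        (HeightOneSpectrum.adicCompletion.continuous_toCompletion K v))
  let _ : Algebra (v.adicCompletion K) (w.adicCompletion F) := f.toAlgebra
  have htower : IsScalarTower K (v.adicCompletion K) (w.adicCompletion F) := by
    refine IsScalarTower.of_algebraMap_eq fun x => ?_
    apply HeightOneSpectrum.adicCompletion.ext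
    exact (UniformSpace.Completion.mapRingHom_coe hf₀.continuous
      ((WithVal.equiv (v.valuation K)).symm x)).symm
  refine ⟨_, htower, ?_⟩
  exact finite_and_adjoin_range_eq_top_of_denseRange (K := K) hf (w.denseRange_algebraMap F)

theorem finite_and_adjoin_range_completion_eq_top (v : InfinitePlace K) (w : InfinitePlace F)
    [w.LiesOver v] :
    Module.Finite v.Completion w.Completion ∧
      Algebra.adjoin v.Completion (Set.range (algebraMap F w.Completion)) = ⊤ := by
  let _ : NontriviallyNormedField v.Completion :=
    { (inferInstance : NormedField v.Completion) with
      non_trivial := by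
        refine ⟨((2 : WithAbs v.1) : v.Completion), ?_⟩
        rw [InfinitePlace.Completion.norm_coe, map_ofNat, ← InfinitePlace.norm_embedding_eq,
          map_ofNat]
        norm_num }
  refine finite_and_adjoin_range_eq_top_of_denseRange (K := K)
    NumberField.LiesOver.continuous_completionMap ?_
  exact (InfinitePlace.Completion.denseRange_coe w).comp
    (WithAbs.equiv w.1).symm.surjective.denseRange (InfinitePlace.Completion.continuous_coe w)

end Completion

/-! ### Selmer groups -/

namespace WeierstrassCurve

noncomputable section

open scoped Classical WeierstrassCurve.Affine
open NumberField IsDedekindDomain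
open scoped NumberField.LiesOver

theorem mem_selmerGroup_iff {K F Ω : Type*} [Field K] [Field F] [NumberField F] [Field Ω]
    [Algebra K F] [Algebra K Ω] [Algebra F Ω] [IsScalarTower K F Ω] [IsAlgClosure F Ω]
    (W : WeierstrassCurve K) {n : ℕ} {x : W.galH1 F Ω n} :
    x ∈ W.selmerGroup F Ω n ↔
      (∀ (v : HeightOneSpectrum (𝓞 F)) (ι : Ω →ₐ[F] AlgebraicClosure (v.adicCompletion F)),
        W.galH1Res (v.adicCompletion F) n ι x ∈
          W.kummerImage (v.adicCompletion F) (AlgebraicClosure (v.adicCompletion F)) n) ∧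
      ∀ (v : InfinitePlace F) (ι : Ω →ₐ[F] AlgebraicClosure v.Completion),
        W.galH1Res v.Completion n ι x ∈
          W.kummerImage v.Completion (AlgebraicClosure v.Completion) n := by
  simp only [selmerGroup, AddSubgroup.mem_inf, AddSubgroup.mem_iInf, AddSubgroup.mem_comap]

variable {K F Ω : Type*} [Field K] [NumberField K] [Field F] [NumberField F] [Field Ω]
    [Algebra K F] [Algebra K Ω] [Algebra F Ω] [IsScalarTower K F Ω]
    [IsAlgClosure K Ω] [IsAlgClosure F Ω] (W : WeierstrassCurve K) {n : ℕ}

theorem galH1Res_id_mem_selmerGroup {x : W.galH1 K Ω n} (hx : x ∈ W.selmerGroup K Ω n) :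
    W.galH1Res F n (AlgHom.id K Ω) x ∈ W.selmerGroup F Ω n := by
  rw [mem_selmerGroup_iff] at hx ⊢
  refine ⟨fun w j => ?_, fun w j => ?_⟩
  · let v : HeightOneSpectrum (𝓞 K) := ⟨w.asIdeal.under (𝓞 K), inferInstance,
      Ideal.under_ne_bot (𝓞 K) w.ne_bot⟩
    have : w.asIdeal.LiesOver v.asIdeal := ⟨rfl⟩
    obtain ⟨_, _, _, hgen⟩ := exists_adicCompletion_algebra v w
    have : IsScalarTower K (v.adicCompletion K) (AlgebraicClosure (w.adicCompletion F)) :=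
      .to₁₂₄ K (v.adicCompletion K) (w.adicCompletion F) _
    exact W.galH1Res_galH1Res_id_mem_kummerImage (hx.1 v) j
  · let v : InfinitePlace K := w.comap (algebraMap K F)
    have : w.LiesOver v := ⟨rfl⟩
    have : IsScalarTower K v.Completion (AlgebraicClosure w.Completion) :=
      .to₁₂₄ K v.Completion w.Completion _
    exact W.galH1Res_galH1Res_id_mem_kummerImage (hx.2 v) j

theorem mem_selmerGroup_of_galH1Res_id_mem [IsGalois K F] (hd : n.Coprime (Module.finrank K F))
    {x : W.galH1 K Ω n} (hx : W.galH1Res F n (AlgHom.id K Ω) x ∈ W.selmerGroup F Ω n) :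
    x ∈ W.selmerGroup K Ω n := by
  rw [mem_selmerGroup_iff] at hx ⊢
  refine ⟨fun v ι => ?_, fun v ι => ?_⟩
  · obtain ⟨w, hw⟩ : ∃ w : HeightOneSpectrum (𝓞 F), w.asIdeal.LiesOver v.asIdeal := by
      have := v.isMaximal
      obtain ⟨P, hP, hPv⟩ := Ideal.exists_maximal_ideal_liesOver_of_isIntegral (S := 𝓞 F) v.asIdeal
      exact ⟨⟨P, hP.isPrime, Ideal.ne_bot_of_liesOver_of_ne_bot v.ne_bot P⟩, hPv⟩
    obtain ⟨_, _, _, hgen⟩ := exists_adicCompletion_algebra v w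
    have : IsScalarTower K (v.adicCompletion K) (AlgebraicClosure (w.adicCompletion F)) :=
      .to₁₂₄ K (v.adicCompletion K) (w.adicCompletion F) _
    have : CharZero (v.adicCompletion K) := charZero_of_injective_algebraMap
      (algebraMap K _).injective
    exact W.galH1Res_mem_kummerImage_of_coprime hd hgen (hx.1 w) ι
  · obtain ⟨w, hw⟩ := InfinitePlace.comap_surjective (K := F) v
    have : w.LiesOver v := ⟨congrArg Subtype.val hw⟩
    obtain ⟨_, hgen⟩ := finite_and_adjoin_range_completion_eq_top v w
    have : IsScalarTower K v.Completion (AlgebraicClosure w.Completion) :=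
      .to₁₂₄ K v.Completion w.Completion _
    have : CharZero v.Completion := charZero_of_injective_algebraMap (algebraMap K _).injective
    exact W.galH1Res_mem_kummerImage_of_coprime hd hgen (hx.2 w) ι

end

end WeierstrassCurve

theorem lemma3p8 {K F Ω : Type*} [Field K] [NumberField K] [Field F] [NumberField F] [Field Ω]
    [Algebra K F] [IsGalois K F] [Algebra K Ω] [Algebra F Ω] [IsScalarTower K F Ω]
    [IsAlgClosure K Ω] [IsAlgClosure F Ω]
    (W : WeierstrassCurve K) [W.IsElliptic] (n : ℕ) (hn : 0 < n)
    (hd : n.Coprime (Module.finrank K F)) :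
    ∃ e : W.selmerGroup K Ω n ≃+ W.selmerGroupInvariants F Ω n,
      ∀ x : W.selmerGroup K Ω n,
        (e x : W.galH1 F Ω n) = W.galH1Res F n (AlgHom.id K Ω) (x : W.galH1 K Ω n) := by
  let f : W.selmerGroup K Ω n →+ W.selmerGroupInvariants F Ω n :=
    ((W.galH1Res F n (AlgHom.id K Ω)).comp (W.selmerGroup K Ω n).subtype).codRestrict _
      fun x => ⟨W.galH1Res_id_mem_selmerGroup x.2, W.smul_galH1Res_id n x.1⟩
  refine ⟨AddEquiv.ofBijective f ⟨fun x y h => ?_, fun y => ?_⟩, fun x => rfl⟩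
  · exact Subtype.ext (W.galH1Res_id_injective hd (congrArg Subtype.val h))
  · obtain ⟨x, hx⟩ := W.exists_galH1Res_eq_of_fixed hd y.1 y.2.2
    exact ⟨⟨x, W.mem_selmerGroup_of_galH1Res_id_mem hd (by rw [hx]; exact y.2.1)⟩,
      Subtype.ext hx⟩
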